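/- Let $M$ be a real $n\times n$ matrix. Call $M$ nonderogatory if its characteristic polynomial $\chi_M$ and its minimal polynomial coincide. Let $\mathbb R[M]$ be the (commutative) algebra of real polynomials in $M$, and let $\mathcal G_M=\mathbb R[M]\ltimes\mathbb R^n$ be the real Lie algebra with underlying vector space $\mathbb R[M]\oplus\mathbb R^n$ and bracket $[a,b]=[x,y]=0$, $[a,x]=ax$ for $a,b\in\mathbb R[M]$, $x,y\in\mathbb R^n$. For $n\ge 1$ let $\mathfrak D_0^n:=\mathcal G_{M_0}$, where $M_0=\sum_{i=1}^{n-1}E_{i,i+1}$ is $n\times n$. For even $n\ge 2$ let $\mathfrak D_{0,1}^n:=\mathcal G_{M_{0,1}}$, where $M_{0,1}=\sum_{j=0}^{n/2-1}(E_{2j+2,2j+1}-E_{2j+1,2j+2})+\sum_{j=1}^{n-2}E_{j,j+2}$ is $n\times n$. (Both have dimension $2n$.) For $\mathbb K=\mathbb R$ or $\mathbb C$ let $\mathfrak{aff}(\mathbb K)$ be the Lie algebra of the matrices $\begin{pmatrix}z_1&z_2\\0&0\end{pmatrix}$, $z_1,z_2\in\mathbb K$, with the commutator as bracket, seen as a real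 Lie algebra. The multiplicity of a real eigenvalue is its multiplicity as a root of $\chi_M$; the multiplicity of a pair $z,\bar z$ of nonreal eigenvalues is the greatest integer $m$ such that $\big((X-\mathrm{Re}\,z)^2+(\mathrm{Im}\,z)^2\big)^m$ divides $\chi_M$. **Theorem.** Let $M$ be a nonderogatory real $n\times n$ matrix whose distinct real eigenvalues are $\lambda_1,\dots,\lambda_p$, with multiplicities $k_1,\dots,k_p$, and whose distinct nonreal eigenvalues are $z_1,\bar z_1,\dots,z_q,\bar z_q$, the pairs $z_j,\bar z_j$ having multiplicities $m_1,\dots,m_q$. Then $n=k_1+\dots+k_p+2(m_1+\dots+m_q)$, and the real Lie algebra $\mathcal G_M$ is isomorphic to the direct sum $$\mathfrak D_0^{k_1}\oplus\dots\oplus\mathfrak D_0^{k_p}\oplus\mathfrak D_{0,1}^{2m_1}\oplus\dots\oplus\mathfrak D_{0,1}^{2m_q}.$$ In particular, for a nonderogatory real $n\times n$ matrix $M$: (a) if $M$ has $n$ distinct real eigenvalues, then $\mathcal G_M$ is isomorphic to the direct sum of $n$ copies of $\mathfrak{aff}(\mathbb R)$; (b) if $M$ has only one complex eigenvalue, and it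 is real, then $\mathcal G_M$ is isomorphic to $\mathfrak D_0^n$; (c) if $M$ has $n$ distinct nonreal eigenvalues, then $n$ is even and $\mathcal G_M$ is isomorphic to the direct sum of $n/2$ copies of $\mathfrak{aff}(\mathbb C)$; (d) if $M$ has exactly two complex eigenvalues, and they are nonreal and conjugate to each other, then $n$ is even and $\mathcal G_M$ is isomorphic to $\mathfrak D_{0,1}^n$. -/

import Mathlib

open scoped DirectSum

-- The bracket of an associative ring is the commutator.
attribute [local instance 100] LieRing.ofAssociativeRing

noncomputable section

namespace NonderogatoryLie

variable {ι : Type*} [Fintype ι] [DecidableEq ι]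

/-- A real square matrix is nonderogatory when its characteristic and minimal polynomials
coincide. -/
def IsNonderogatory (M : Matrix ι ι ℝ) : Prop :=
  M.charpoly = minpoly ℝ M

/-- The real number `x` is an eigenvalue of the real matrix `M`. -/
def IsRealEigenvalue (M : Matrix ι ι ℝ) (x : ℝ) : Prop :=
  Module.End.HasEigenvalue (Matrix.toLin' M) x

/-- The complex number `z` is an eigenvalue of the real matrix `M`, seen as a complex matrix. -/
def IsComplexEigenvalue (M : Matrix ι ι ℝ) (z : ℂ) : Prop :=
  Module.End.HasEigenvalue (Matrix.toLin' (M.map Complex.ofReal)) z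

/-- The (algebraic) multiplicity of a real number as an eigenvalue of `M`. -/
def realMultiplicity (M : Matrix ι ι ℝ) (x : ℝ) : ℕ :=
  M.charpoly.rootMultiplicity x

open Polynomial in
/-- The multiplicity of the pair of nonreal eigenvalues `z`, `conj z` of `M`: the greatest `m`
such that `((X - Re z)² + (Im z)²) ^ m` divides the characteristic polynomial of `M`. -/
def pairMultiplicity (M : Matrix ι ι ℝ) (z : ℂ) : ℕ :=
  multiplicity ((X - C z.re) ^ 2 + C (z.im ^ 2)) M.charpoly

/-- The algebra `ℝ[M]` of real polynomials in `M`. Its Lie bracket is the commutator of matrices,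
which vanishes identically since `ℝ[M]` is commutative. -/
abbrev polyAlg (M : Matrix ι ι ℝ) : Subalgebra ℝ (Matrix ι ι ℝ) :=
  Algebra.adjoin ℝ {M}

/-- A matrix, acting on column vectors, as a derivation of the abelian Lie algebra `ι → ℝ`
(the bracket of `ι → ℝ` is the commutator of the commutative ring `ι → ℝ`, that is, `0`). -/
def mulVecDerivation (A : Matrix ι ι ℝ) : LieDerivation ℝ (ι → ℝ) (ι → ℝ) where
  toLinearMap := Matrix.mulVecLin A
  leibniz' x y := by
    simp [LieRing.of_associative_ring_bracket, mul_comm]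

/-- The action of `ℝ[M]` on `ι → ℝ` by multiplication of matrices and vectors. -/
def polyAction (M : Matrix ι ι ℝ) :
    polyAlg M →ₗ⁅ℝ⁆ LieDerivation ℝ (ι → ℝ) (ι → ℝ) where
  toFun A := mulVecDerivation (A : Matrix ι ι ℝ)
  map_add' A B := by
    ext x : 1
    simp [mulVecDerivation]
  map_smul' c A := by
    ext x : 1
    simp [mulVecDerivation]
  map_lie' {A B} := by
    ext x : 1
    simp [mulVecDerivation, LieRing.of_associative_ring_bracket,
      LieDerivation.lie_apply]

/-- The semidirect sum `𝒢_M = ℝ[M] ⋉ ℝⁿ`, with `[a, b] = [x, y] = 0` and `[a, x] = a x`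
for `a`, `b` in `ℝ[M]` and `x`, `y` in `ℝⁿ`. -/
abbrev G (M : Matrix ι ι ℝ) : Type _ :=
  LieAlgebra.SemiDirectSum (ι → ℝ) (polyAlg M) (polyAction M)

/-- The principal nilpotent matrix `∑ E_{i,i+1}`. -/
def M₀ (n : ℕ) : Matrix (Fin n) (Fin n) ℝ :=
  Matrix.of fun i j => if (j : ℕ) = i + 1 then 1 else 0

/-- The Lie algebra `𝔇₀ⁿ = ℝ[M₀] ⋉ ℝⁿ`, of dimension `2n`. -/
abbrev D₀ (n : ℕ) : Type := G (M₀ n)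

/-- `M_s = -∑_{j} (E_{2j+1,2j+2} - E_{2j+2,2j+1})` for even `n`
(indices in the formula start at `1`, indices of `Fin n` at `0`). -/
def Mₛ (n : ℕ) : Matrix (Fin n) (Fin n) ℝ :=
  Matrix.of fun i j =>
    if Even (i : ℕ) ∧ (j : ℕ) = i + 1 then -1
    else if Even (j : ℕ) ∧ (i : ℕ) = j + 1 then 1
    else 0

/-- `M_n = ∑_{j} E_{j,j+2}`. -/
def Mₙ (n : ℕ) : Matrix (Fin n) (Fin n) ℝ :=
  Matrix.of fun i j => if (j : ℕ) = i + 2 then 1 else 0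

/-- The `n × n` matrix `M_{0,1} = M_s + M_n` (used for even `n`): diagonal blocks
`!![0, -1; 1, 0]` and identity blocks of size two just above the diagonal. -/
def M₀₁ (n : ℕ) : Matrix (Fin n) (Fin n) ℝ := Mₛ n + Mₙ n

/-- The Lie algebra `𝔇_{0,1}ⁿ = ℝ[M_{0,1}] ⋉ ℝⁿ`, of dimension `2n`, where `n` is even. -/
abbrev D₀₁ (n : ℕ) : Type := G (M₀₁ n)

/-- The Lie algebra `𝔞𝔣𝔣(𝕜)` of the group of affine motions of the line `𝕜`, seen as a real Lie
algebra: the matrices `!![z₁, z₂; 0, 0]` with entries in `𝕜`, with the commutator as bracket. -/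
def aff (𝕜 : Type*) [Field 𝕜] [Algebra ℝ 𝕜] : LieSubalgebra ℝ (Matrix (Fin 2) (Fin 2) 𝕜) where
  carrier := {A | A 1 0 = 0 ∧ A 1 1 = 0}
  add_mem' {A B} hA hB := by
    change A 1 0 = 0 ∧ A 1 1 = 0 at hA
    change B 1 0 = 0 ∧ B 1 1 = 0 at hB
    change (A + B) 1 0 = 0 ∧ (A + B) 1 1 = 0
    simp [hA.1, hA.2, hB.1, hB.2]
  zero_mem' := by simp
  smul_mem' c A hA := by
    change A 1 0 = 0 ∧ A 1 1 = 0 at hA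
    change (c • A) 1 0 = 0 ∧ (c • A) 1 1 = 0
    simp [hA.1, hA.2]
  lie_mem' {A B} hA hB := by
    change A 1 0 = 0 ∧ A 1 1 = 0 at hA
    change B 1 0 = 0 ∧ B 1 1 = 0 at hB
    change (A * B - B * A) 1 0 = 0 ∧ (A * B - B * A) 1 1 = 0
    simp [Matrix.mul_apply, Fin.sum_univ_two, hA.1, hA.2, hB.1, hB.2]

end NonderogatoryLie

end

noncomputable section

namespace NonderogatoryLie

/-! For a commutative real algebra `B`, let `AffLie B` be the semidirect sum of `B` with its regular
module. Since ℝⁿ is not a finite union of proper subspaces, some vector `v` has annihilator exactly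
the ideal generated by the minimal polynomial (`exists_minpoly_dvd_of_mulVec_eq_zero`). When `M` is
nonderogatory that polynomial has degree n, so p ↦ p(M)v identifies ℝⁿ with ℝ[X]/(χ_M) ≅ ℝ[M], and
`G M` is `AffLie` of this quotient (`IsNonderogatory.nonempty_equiv`). Only the algebra ℝ[X]/(χ_M)
matters from then on. Factoring χ_M over ℝ and applying the Chinese remainder theorem splits the
algebra, and `AffLie` turns products into direct sums. A real affine change of variable moves each
primary factor to ℝ[X]/(X^k) or ℝ[X]/((X²+1)^m). The model matrices also have cyclic vectors, so
these factors give `D₀ k` and `D₀₁ (2 * m)` (`nonempty_D₀_equiv`, `nonempty_D₀₁_equiv`). For simple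
roots the quotients are ℝ and ℂ, which give `aff`. -/

/-- The Lie algebra of infinitesimal affine motions of the line over a commutative real algebra `B`:
the space `B × B` with bracket `[(a, x), (b, y)] = (0, a y - b x)`. -/
@[ext] structure AffLie (B : Type*) where
  /-- the linear part -/
  lin : B
  /-- the translation part -/
  trans : B

/-! ### Affine Lie algebras of commutative algebras: functoriality and products. -/

namespace AffLie

variable {B C : Type*} [CommRing B] [CommRing C]

/-- The pair underlying an element of `AffLie B`. -/
def toProd : AffLie B ≃ B × B where
  toFun u := (u.lin, u.trans)
  invFun u := ⟨u.1, u.2⟩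
  left_inv _ := rfl
  right_inv _ := rfl

instance : AddCommGroup (AffLie B) := toProd.addCommGroup

instance [Algebra ℝ B] : Module ℝ (AffLie B) := toProd.module ℝ

instance : Bracket (AffLie B) (AffLie B) where
  bracket u v := ⟨0, u.lin * v.trans - v.lin * u.trans⟩

@[simp] lemma zero_lin : (0 : AffLie B).lin = 0 := rfl
@[simp] lemma zero_trans : (0 : AffLie B).trans = 0 := rfl
@[simp] lemma add_lin (u v : AffLie B) : (u + v).lin = u.lin + v.lin := rfl
@[simp] lemma add_trans (u v : AffLie B) : (u + v).trans = u.trans + v.trans := rfl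
@[simp] lemma smul_lin [Algebra ℝ B] (c : ℝ) (u : AffLie B) : (c • u).lin = c • u.lin := rfl
@[simp] lemma smul_trans [Algebra ℝ B] (c : ℝ) (u : AffLie B) :
    (c • u).trans = c • u.trans := rfl
@[simp] lemma lie_lin (u v : AffLie B) : ⁅u, v⁆.lin = 0 := rfl
@[simp] lemma lie_trans (u v : AffLie B) :
    ⁅u, v⁆.trans = u.lin * v.trans - v.lin * u.trans := rfl

instance : LieRing (AffLie B) where
  add_lie _ _ _ := by ext <;> simp; ring
  lie_add _ _ _ := by ext <;> simp; ring
  lie_self _ := by ext <;> simp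
  leibniz_lie _ _ _ := by ext <;> simp; ring

instance [Algebra ℝ B] : LieAlgebra ℝ (AffLie B) where
  lie_smul _ _ _ := by ext <;> simp [smul_sub]

variable [Algebra ℝ B] [Algebra ℝ C]

/-- Isomorphic algebras have isomorphic affine Lie algebras. -/
def congr (e : B ≃ₐ[ℝ] C) : AffLie B ≃ₗ⁅ℝ⁆ AffLie C where
  toFun u := ⟨e u.lin, e u.trans⟩
  invFun u := ⟨e.symm u.lin, e.symm u.trans⟩
  left_inv u := by ext <;> simp
  right_inv u := by ext <;> simp
  map_add' u v := by ext <;> simp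
  map_smul' c u := by ext <;> simp
  map_lie' := by intros; ext <;> simp

/-- The affine Lie algebra of a product is the product of the affine Lie algebras. -/
def prodEquiv {L₁ L₂ : Type*} [LieRing L₁] [LieRing L₂] [LieAlgebra ℝ L₁] [LieAlgebra ℝ L₂]
    (e₁ : AffLie B ≃ₗ⁅ℝ⁆ L₁) (e₂ : AffLie C ≃ₗ⁅ℝ⁆ L₂) : AffLie (B × C) ≃ₗ⁅ℝ⁆ L₁ × L₂ where
  toFun u := (e₁ ⟨u.lin.1, u.trans.1⟩, e₂ ⟨u.lin.2, u.trans.2⟩)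
  invFun u := ⟨((e₁.symm u.1).lin, (e₂.symm u.2).lin), ((e₁.symm u.1).trans, (e₂.symm u.2).trans)⟩
  left_inv u := by ext <;> simp
  right_inv u := Prod.ext (e₁.apply_symm_apply u.1) (e₂.apply_symm_apply u.2)
  map_add' u v := by
    ext
    · exact map_add e₁ ⟨u.lin.1, u.trans.1⟩ ⟨v.lin.1, v.trans.1⟩
    · exact map_add e₂ ⟨u.lin.2, u.trans.2⟩ ⟨v.lin.2, v.trans.2⟩
  map_smul' c u := by
    ext
    · exact map_smul e₁ c ⟨u.lin.1, u.trans.1⟩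
    · exact map_smul e₂ c ⟨u.lin.2, u.trans.2⟩
  map_lie' {u v} := by
    ext
    · exact LieEquiv.map_lie e₁ ⟨u.lin.1, u.trans.1⟩ ⟨v.lin.1, v.trans.1⟩
    · exact LieEquiv.map_lie e₂ ⟨u.lin.2, u.trans.2⟩ ⟨v.lin.2, v.trans.2⟩

/-- The affine Lie algebra of a finite product is the direct sum of the affine Lie algebras. -/
def piEquiv {κ : Type*} [Fintype κ] [DecidableEq κ] {A : κ → Type*} [∀ i, CommRing (A i)]
    [∀ i, Algebra ℝ (A i)] {L : κ → Type*} [∀ i, LieRing (L i)] [∀ i, LieAlgebra ℝ (L i)]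
    (e : ∀ i, AffLie (A i) ≃ₗ⁅ℝ⁆ L i) : AffLie (∀ i, A i) ≃ₗ⁅ℝ⁆ ⨁ i, L i where
  toFun u := DirectSum.mk L Finset.univ fun i => e i ⟨u.lin i, u.trans i⟩
  invFun u := ⟨fun i => ((e i).symm (u i)).lin, fun i => ((e i).symm (u i)).trans⟩
  left_inv u := by
    ext i
    all_goals
      simp only [DirectSum.mk_apply_of_mem (Finset.mem_univ i)]
      simp
  right_inv u := by
    apply DFinsupp.ext
    intro i
    rw [DirectSum.mk_apply_of_mem (Finset.mem_univ i)]
    exact (e i).apply_symm_apply (u i)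
  map_add' u v := by
    apply DFinsupp.ext
    intro i
    rw [DirectSum.add_apply]
    simp only [DirectSum.mk_apply_of_mem (Finset.mem_univ i)]
    exact map_add (e i) ⟨u.lin i, u.trans i⟩ ⟨v.lin i, v.trans i⟩
  map_smul' c u := by
    apply DFinsupp.ext
    intro i
    rw [RingHom.id_apply, DirectSum.smul_apply]
    simp only [DirectSum.mk_apply_of_mem (Finset.mem_univ i)]
    exact map_smul (e i) c ⟨u.lin i, u.trans i⟩
  map_lie' {u v} := by
    apply DFinsupp.ext
    intro i
    rw [DirectSum.bracket_apply]
    simp only [DirectSum.mk_apply_of_mem (Finset.mem_univ i)]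
    exact LieEquiv.map_lie (e i) ⟨u.lin i, u.trans i⟩ ⟨v.lin i, v.trans i⟩

/-- For a field `𝕜`, the Lie algebra `AffLie 𝕜` is the matrix Lie algebra `aff 𝕜`. -/
def equivAff (𝕜 : Type*) [Field 𝕜] [Algebra ℝ 𝕜] : AffLie 𝕜 ≃ₗ⁅ℝ⁆ aff 𝕜 where
  toFun u := ⟨!![u.lin, u.trans; 0, 0], by constructor <;> rfl⟩
  invFun A := ⟨A.1 0 0, A.1 0 1⟩
  left_inv u := rfl
  right_inv A := by
    obtain ⟨A, h₁, h₂⟩ := A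
    ext i j
    fin_cases i <;> fin_cases j
    exacts [rfl, rfl, h₁.symm, h₂.symm]
  map_add' u v := by
    ext i j
    fin_cases i <;> fin_cases j <;> simp
  map_smul' c u := by
    ext i j
    fin_cases i <;> fin_cases j <;> simp
  map_lie' {u v} := by
    ext i j
    fin_cases i <;> fin_cases j <;>
      simp [LieRing.of_associative_ring_bracket, mul_comm]

end AffLie

/-! ### Passage from the semidirect sum to the affine Lie algebra. -/

/-- If `ℝ[M]` is isomorphic to `B` and `ℝⁿ` to the regular module of `B`, then `𝒢_M` is the affine
Lie algebra of `B`. -/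
def equivAffLie {ι : Type*} [Fintype ι] [DecidableEq ι] {M : Matrix ι ι ℝ} {B : Type*} [CommRing B]
    [Algebra ℝ B] (e : polyAlg M ≃ₐ[ℝ] B) (f : (ι → ℝ) ≃ₗ[ℝ] B)
    (h : ∀ (a : polyAlg M) (x : ι → ℝ), f (a.1.mulVec x) = e a * f x) :
    G M ≃ₗ⁅ℝ⁆ AffLie B where
  -- In the semidirect sum, `left` is the vector part and `right` the part in ℝ[M].
  toFun u := ⟨e u.right, f u.left⟩
  invFun u := ⟨f.symm u.trans, e.symm u.lin⟩
  left_inv u := by ext <;> simp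
  right_inv u := by ext <;> simp
  map_add' u v := by ext <;> simp
  map_smul' c u := by ext <;> simp
  map_lie' {u v} := by
    ext
    · simp [LieRing.of_associative_ring_bracket, mul_comm]
    · have h₀ : ⁅u.left, v.left⁆ = 0 := by
        simp [LieRing.of_associative_ring_bracket, mul_comm]
      have h₁ : ∀ (a : polyAlg M) (x : ι → ℝ), polyAction M a x = a.1.mulVec x := fun _ _ => rfl
      simp [h₀, h₁, h]

/-! ### Quotients of ℝ[X]: Chinese remainder theorem and change of variable. -/

open Polynomial

/-- The quotient algebra `ℝ[X]/(f)`. -/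
abbrev PolyQuot (f : ℝ[X]) : Type := ℝ[X] ⧸ Ideal.span {f}

lemma mk_eq_zero_iff_dvd {f p : ℝ[X]} : Ideal.Quotient.mk (Ideal.span {f}) p = 0 ↔ f ∣ p := by
  rw [Ideal.Quotient.eq_zero_iff_mem, Ideal.mem_span_singleton]

/-- A surjective homomorphism with kernel `(f)` identifies `ℝ[X]/(f)` with its codomain. -/
def quotEquiv {f : ℝ[X]} {B : Type*} [Ring B] [Algebra ℝ B] (φ : ℝ[X] →ₐ[ℝ] B)
    (hφ : Function.Surjective φ) (hker : ∀ p, φ p = 0 ↔ f ∣ p) : PolyQuot f ≃ₐ[ℝ] B :=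
  (Ideal.quotientEquivAlgOfEq ℝ (by
    ext p
    rw [Ideal.mem_span_singleton, RingHom.mem_ker]
    exact (hker p).symm)).trans (Ideal.quotientKerAlgEquivOfSurjective hφ)

/-- Chinese remainder theorem for two polynomials. -/
def quotMulEquiv {f g : ℝ[X]} (h : IsCoprime f g) : PolyQuot (f * g) ≃ₐ[ℝ] PolyQuot f × PolyQuot g :=
  quotEquiv (AlgHom.prod (Ideal.Quotient.mkₐ ℝ _) (Ideal.Quotient.mkₐ ℝ _))
    (by
      rintro ⟨x, y⟩
      obtain ⟨x, rfl⟩ := Ideal.Quotient.mk_surjective x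
      obtain ⟨y, rfl⟩ := Ideal.Quotient.mk_surjective y
      obtain ⟨a, b, hab⟩ := h
      -- By the Bézout relation, `a * f` is 0 modulo `f` and 1 modulo `g`, and `b * g` the reverse.
      refine ⟨y * (a * f) + x * (b * g), Prod.ext ?_ ?_⟩
      · refine Ideal.Quotient.eq.2 (Ideal.mem_span_singleton.2 ⟨a * (y - x), ?_⟩)
        linear_combination x * hab
      · refine Ideal.Quotient.eq.2 (Ideal.mem_span_singleton.2 ⟨b * (x - y), ?_⟩)
        linear_combination y * hab)
    (fun p => by
      refine Prod.ext_iff.trans (Iff.trans (and_congr mk_eq_zero_iff_dvd mk_eq_zero_iff_dvd) ?_)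
      exact ⟨fun hp => h.mul_dvd hp.1 hp.2,
        fun hp => ⟨(dvd_mul_right f g).trans hp, (dvd_mul_left g f).trans hp⟩⟩)

/-- Chinese remainder theorem for a finite family of polynomials. -/
def quotProdEquiv {κ : Type*} [Fintype κ] {f : κ → ℝ[X]}
    (h : Pairwise (Function.onFun IsCoprime f)) : PolyQuot (∏ i, f i) ≃ₐ[ℝ] ∀ i, PolyQuot (f i) :=
  quotEquiv (AlgHom.pi fun i => Ideal.Quotient.mkₐ ℝ (Ideal.span {f i}))
    (fun x => by
      obtain ⟨r, hr⟩ := Ideal.pi_quotient_surjective (I := fun i => Ideal.span {f i})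
        (fun i j hij => (Ideal.isCoprime_span_singleton_iff _ _).2 (h hij)) x
      exact ⟨r, funext hr⟩)
    (fun p => by
      refine funext_iff.trans (Iff.trans (forall_congr' fun i => mk_eq_zero_iff_dvd) ?_)
      exact ⟨fun hp => Fintype.prod_dvd_of_coprime h hp,
        fun hp i => (Finset.dvd_prod_of_mem f (Finset.mem_univ i)).trans hp⟩)

/-- An affine change of variable identifies quotients of `ℝ[X]`. -/
def quotCompEquiv {f g : ℝ[X]} {a b : ℝ} (ha : a ≠ 0)
    (h : Associated (f.comp (C a * X + C b)) g) : PolyQuot f ≃ₐ[ℝ] PolyQuot g :=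
  haveI := invertibleOfNonzero ha
  quotEquiv ((Ideal.Quotient.mkₐ ℝ (Ideal.span {g})).comp
      (algEquivCMulXAddC a b : ℝ[X] →ₐ[ℝ] ℝ[X]))
    (Ideal.Quotient.mk_surjective.comp (algEquivCMulXAddC a b).surjective)
    (fun p => by
      refine mk_eq_zero_iff_dvd.trans ?_
      rw [← h.dvd_iff_dvd_left]
      have hf : f.comp (C a * X + C b) = algEquivCMulXAddC a b f := by
        rw [algEquivCMulXAddC_apply, comp_eq_aeval]
      rw [hf]
      exact map_dvd_iff (algEquivCMulXAddC a b))

/-! ### Real quadratics with nonreal roots, and the primary quotients. -/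

/-- The monic real polynomial with roots `z` and `conj z`. -/
def pairPoly (z : ℂ) : ℝ[X] := (X - C z.re) ^ 2 + C (z.im ^ 2)

/-- The expanded form is the one that `quadratic_dvd_of_aeval_eq_zero_im_ne_zero` divides by. -/
lemma pairPoly_eq (z : ℂ) : pairPoly z = X ^ 2 - C (2 * z.re) * X + C (‖z‖ ^ 2) := by
  rw [pairPoly, ← Complex.normSq_eq_norm_sq, Complex.normSq_apply]
  simp only [map_add, map_mul, map_pow, map_ofNat]
  ring

lemma pairPoly_monic (z : ℂ) : (pairPoly z).Monic := by
  unfold pairPoly; monicity!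

lemma natDegree_pairPoly (z : ℂ) : (pairPoly z).natDegree = 2 := by
  unfold pairPoly; compute_degree!

lemma aeval_pairPoly (z w : ℂ) :
    aeval w (pairPoly z) = (w - z) * (w - starRingEnd ℂ z) := by
  have hz : (z.re : ℂ) ^ 2 + (z.im : ℂ) ^ 2 = z * starRingEnd ℂ z := by
    rw [Complex.mul_conj, Complex.normSq_apply]; push_cast; ring
  have h₂ : 2 * (z.re : ℂ) = z + starRingEnd ℂ z := by rw [Complex.add_conj]; push_cast; ring
  simp only [pairPoly, map_add, map_sub, map_pow, aeval_X, aeval_C, Complex.coe_algebraMap]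
  linear_combination hz - w * h₂

lemma aeval_eq_zero_iff_pairPoly_dvd {z : ℂ} (hz : z.im ≠ 0) (p : ℝ[X]) :
    aeval z p = 0 ↔ pairPoly z ∣ p := by
  constructor
  · intro h
    rw [pairPoly_eq]
    exact quadratic_dvd_of_aeval_eq_zero_im_ne_zero p h hz
  · rintro ⟨r, rfl⟩
    rw [map_mul, aeval_pairPoly, sub_self, zero_mul, zero_mul]

lemma pairPoly_irreducible {z : ℂ} (hz : z.im ≠ 0) : Irreducible (pairPoly z) := by
  rw [(pairPoly_monic z).irreducible_iff_roots_eq_zero_of_degree_le_three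
    (natDegree_pairPoly z).ge (by rw [natDegree_pairPoly]; norm_num)]
  refine Multiset.eq_zero_of_forall_notMem fun x hx => ?_
  have hx : (x - z.re) ^ 2 + z.im ^ 2 = 0 := by
    simpa [pairPoly] using isRoot_of_mem_roots hx
  have : 0 < z.im ^ 2 := by positivity
  nlinarith [sq_nonneg (x - z.re)]

/-- Evaluation at `x` identifies `ℝ[X]/(X - x)` with `ℝ`. -/
def quotLinearEquiv (x : ℝ) : PolyQuot (X - C x) ≃ₐ[ℝ] ℝ :=
  quotEquiv (aeval x) (fun y => ⟨C y, by simp⟩) fun p => by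
    rw [dvd_iff_isRoot, IsRoot.def, coe_aeval_eq_eval]

/-- Evaluation at a nonreal `z` identifies `ℝ[X]/((X - Re z)² + (Im z)²)` with `ℂ`. -/
def quotPairEquiv {z : ℂ} (hz : z.im ≠ 0) : PolyQuot (pairPoly z) ≃ₐ[ℝ] ℂ :=
  quotEquiv (aeval z)
    -- As 1 and `z` span ℂ over ℝ, `w` is the value at `z` of a real polynomial of degree at most
    -- one; comparing imaginary parts, then real parts, gives its coefficients.
    (fun w => ⟨C (w.im / z.im) * X + C (w.re - w.im / z.im * z.re), by
      apply Complex.ext <;> simp [hz]⟩)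
    (aeval_eq_zero_iff_pairPoly_dvd hz)

/-- Translating the root of `(X - x) ^ k` to `0`. -/
def quotLinearPowEquiv (x : ℝ) (k : ℕ) : PolyQuot ((X - C x) ^ k) ≃ₐ[ℝ] PolyQuot (X ^ k) :=
  quotCompEquiv (a := 1) (b := x) one_ne_zero (by simp)

/-- Moving the roots `z`, `conj z` of `((X - Re z)² + (Im z)²) ^ m` to `I`, `-I`. -/
def quotPairPowEquiv {z : ℂ} (hz : z.im ≠ 0) (m : ℕ) :
    PolyQuot (pairPoly z ^ m) ≃ₐ[ℝ] PolyQuot ((X ^ 2 + 1) ^ m) :=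
  quotCompEquiv (a := z.im) (b := z.re) hz (by
    -- Substituting (Im z)X + Re z scales the quadratic by (Im z)², a unit, so the two ideals agree.
    have h : (pairPoly z ^ m).comp (C z.im * X + C z.re) = C ((z.im ^ 2) ^ m) * (X ^ 2 + 1) ^ m := by
      simp only [pairPoly, pow_comp, add_comp, sub_comp, X_comp, C_comp, map_pow, ← mul_pow]
      ring
    rw [h]
    exact associated_unit_mul_left _ _ (isUnit_C.2 (isUnit_iff_ne_zero.2 (by positivity))))

/-! ### Cyclic vectors. -/

section CyclicVector

variable {ι : Type*} [Fintype ι] [DecidableEq ι]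

/-- If `v` is a cyclic vector of `M`, with annihilator generated by a polynomial `g` of
degree `n`, then `𝒢_M` is the affine Lie algebra of `ℝ[X]/(g)`. -/
theorem nonempty_equiv_of_cyclic {M : Matrix ι ι ℝ} {g : ℝ[X]}
    (hdeg : g.natDegree = Fintype.card ι) (hM : aeval M g = 0) {v : ι → ℝ}
    (hv : ∀ p : ℝ[X], (aeval M p).mulVec v = 0 → g ∣ p) :
    Nonempty (G M ≃ₗ⁅ℝ⁆ AffLie (PolyQuot g)) := by
  let x : polyAlg M := ⟨M, Algebra.self_mem_adjoin_singleton ℝ M⟩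
  have hx : ∀ p : ℝ[X], ((aeval x p : polyAlg M) : Matrix ι ι ℝ) = aeval M p := fun p =>
    (aeval_algHom_apply (polyAlg M).val x p).symm
  let e : PolyQuot g ≃ₐ[ℝ] polyAlg M := quotEquiv (aeval x)
    (fun a => by
      have ha : a.1 ∈ Algebra.adjoin ℝ {M} := a.2
      rw [Algebra.adjoin_singleton_eq_range_aeval] at ha
      obtain ⟨p, hp⟩ := ha
      exact ⟨p, Subtype.ext ((hx p).trans hp)⟩)
    (fun p => by
      constructor
      · intro hp
        refine hv p ?_
        rw [← hx p, hp, ZeroMemClass.coe_zero, Matrix.zero_mulVec]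
      · rintro ⟨r, rfl⟩
        refine Subtype.ext ?_
        rw [hx, map_mul, hM, zero_mul, ZeroMemClass.coe_zero])
  let f₀ : PolyQuot g →ₗ[ℝ] ι → ℝ :=
    { toFun := fun a => (e a).1.mulVec v
      map_add' := fun a b => by simp [Matrix.add_mulVec]
      map_smul' := fun c a => by simp [Matrix.smul_mulVec] }
  have hf₀ : Function.Injective f₀ := by
    rw [← LinearMap.ker_eq_bot, LinearMap.ker_eq_bot']
    intro a ha
    obtain ⟨p, rfl⟩ := Ideal.Quotient.mk_surjective a
    refine mk_eq_zero_iff_dvd.2 (hv p ?_)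
    rw [← hx p]
    exact ha
  have : Module.Finite ℝ (PolyQuot g) := Module.Finite.of_injective f₀ hf₀
  -- Injectivity suffices, because both sides have dimension `g.natDegree`.
  let f : PolyQuot g ≃ₗ[ℝ] ι → ℝ := f₀.linearEquivOfInjective hf₀ (by
    rw [Module.finrank_fintype_fun_eq_card, ← hdeg, finrank_quotient_span_eq_natDegree])
  refine ⟨equivAffLie e.symm f.symm fun a y => ?_⟩
  apply f.injective
  have hf : ∀ b, f b = (e b).1.mulVec v := fun _ => rfl
  rw [f.apply_symm_apply, hf, map_mul, e.apply_symm_apply, Subalgebra.coe_mul,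
    ← Matrix.mulVec_mulVec, ← hf, f.apply_symm_apply]

lemma gcd_mulVec_eq_zero {M : Matrix ι ι ℝ} {p g : ℝ[X]} {v : ι → ℝ}
    (hp : (aeval M p).mulVec v = 0) (hg : (aeval M g).mulVec v = 0) :
    (aeval M (EuclideanDomain.gcd p g)).mulVec v = 0 := by
  rw [EuclideanDomain.gcd_eq_gcd_ab, mul_comm p, mul_comm g, map_add, map_mul, map_mul,
    Matrix.add_mulVec, ← Matrix.mulVec_mulVec, ← Matrix.mulVec_mulVec, hp, hg]
  simp

lemma mulVec_eq_zero_of_dvd {M : Matrix ι ι ℝ} {p g : ℝ[X]} {v : ι → ℝ} (h : p ∣ g)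
    (hp : (aeval M p).mulVec v = 0) : (aeval M g).mulVec v = 0 := by
  obtain ⟨r, rfl⟩ := h
  rw [mul_comm, map_mul, ← Matrix.mulVec_mulVec, hp, Matrix.mulVec_zero]

/-- The gcd of `p` and `q ^ (k + 1)` also kills `v`, and it is a power of `q` up to a unit. An
exponent at most `k` would make `q ^ k` kill `v`. -/
lemma pow_dvd_of_mulVec_eq_zero {M : Matrix ι ι ℝ} {q : ℝ[X]} (hq : Prime q) {k : ℕ}
    (hM : aeval M (q ^ (k + 1)) = 0) {v : ι → ℝ} (hv : (aeval M (q ^ k)).mulVec v ≠ 0) (p : ℝ[X])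
    (hp : (aeval M p).mulVec v = 0) : q ^ (k + 1) ∣ p := by
  have h := gcd_mulVec_eq_zero hp (g := q ^ (k + 1)) (by rw [hM, Matrix.zero_mulVec])
  obtain ⟨i, hi, hd⟩ := (dvd_prime_pow hq _).1 (EuclideanDomain.gcd_dvd_right p (q ^ (k + 1)))
  obtain rfl : i = k + 1 := by
    by_contra hne
    exact hv (mulVec_eq_zero_of_dvd (hd.dvd.trans (pow_dvd_pow q (by omega))) h)
  exact hd.symm.dvd.trans (EuclideanDomain.gcd_dvd_left _ _)

/-- A vector whose annihilator is generated by the minimal polynomial. -/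
lemma exists_minpoly_dvd_of_mulVec_eq_zero (M : Matrix ι ι ℝ) :
    ∃ v : ι → ℝ, ∀ p : ℝ[X], (aeval M p).mulVec v = 0 → minpoly ℝ M ∣ p := by
  classical
  have hint : IsIntegral ℝ M := Algebra.IsIntegral.isIntegral M
  have h0 : minpoly ℝ M ≠ 0 := minpoly.ne_zero hint
  let F := (UniqueFactorizationMonoid.normalizedFactors (minpoly ℝ M)).toFinset
  -- A vector is bad exactly when a proper divisor of the minimal polynomial kills it, hence when it
  -- lies in one of these kernels of maximal proper divisors.
  let K : ℝ[X] → Submodule ℝ (ι → ℝ) := fun π =>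
    LinearMap.ker (Matrix.mulVecLin (aeval M (minpoly ℝ M / π)))
  have hF : ∀ π ∈ F, Irreducible π ∧ minpoly ℝ M = π * (minpoly ℝ M / π) := by
    intro π hπ
    have hπ := Multiset.mem_toFinset.1 hπ
    have hirr := UniqueFactorizationMonoid.irreducible_of_normalized_factor π hπ
    exact ⟨hirr, (EuclideanDomain.mul_div_cancel' hirr.ne_zero
      (UniqueFactorizationMonoid.dvd_of_mem_normalizedFactors hπ)).symm⟩
  have htop : ⊤ ∉ F.image K := by
    intro h
    obtain ⟨π, hπ, hK⟩ := Finset.mem_image.1 h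
    obtain ⟨hirr, heq⟩ := hF π hπ
    -- If a kernel were the whole space, a proper divisor of the minimal polynomial would annihilate
    -- `M`.
    have hz : aeval M (minpoly ℝ M / π) = 0 := by
      apply Matrix.mulVec_injective
      funext v
      rw [Matrix.zero_mulVec]
      exact LinearMap.mem_ker.1 (hK ▸ Submodule.mem_top : v ∈ K π)
    obtain ⟨c, hc⟩ := minpoly.dvd ℝ M hz
    have h1 : minpoly ℝ M * (π * c) = minpoly ℝ M * 1 := by
      rw [mul_one]; nth_rw 2 [heq]; rw [hc]; ring
    exact hirr.not_isUnit (IsUnit.of_mul_eq_one c (mul_left_cancel₀ h0 h1))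
  -- A vector space over an infinite field is not a finite union of proper subspaces.
  obtain ⟨v, hv⟩ := (Set.ne_univ_iff_exists_notMem _).1 (Subspace.biUnion_ne_univ_of_top_notMem htop)
  simp only [Finset.mem_image, Set.iUnion_exists, Set.biUnion_and', Set.iUnion_iUnion_eq_right,
    Set.mem_iUnion, SetLike.mem_coe, not_exists] at hv
  refine ⟨v, fun p hp => ?_⟩
  have h := gcd_mulVec_eq_zero hp (g := minpoly ℝ M) (by rw [minpoly.aeval, Matrix.zero_mulVec])
  obtain ⟨c, hc⟩ := EuclideanDomain.gcd_dvd_right p (minpoly ℝ M)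
  by_cases hu : IsUnit c
  · refine dvd_trans (Associated.dvd ?_) (EuclideanDomain.gcd_dvd_left p (minpoly ℝ M))
    nth_rw 1 [hc]
    exact associated_mul_unit_left _ _ hu
  -- A prime factor `π` of the cofactor `c` makes the gcd divide `minpoly ℝ M / π`, which puts `v`
  -- in `K π`.
  · exfalso
    have hc0 : c ≠ 0 := by rintro rfl; exact h0 (by rw [hc, mul_zero])
    obtain ⟨π', hirr', hd'⟩ := WfDvdMonoid.exists_irreducible_factor hu hc0
    obtain ⟨π, hπ, hassoc⟩ := UniqueFactorizationMonoid.exists_mem_normalizedFactors_of_dvd h0 hirr'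
      (hd'.trans (Dvd.intro_left _ hc.symm))
    obtain ⟨d, hd⟩ := hassoc.symm.dvd.trans hd'
    obtain ⟨hirr, heq⟩ := hF π (Multiset.mem_toFinset.2 hπ)
    refine hv π (Multiset.mem_toFinset.2 hπ) (LinearMap.mem_ker.2 ?_)
    refine mulVec_eq_zero_of_dvd ⟨d, mul_left_cancel₀ hirr.ne_zero ?_⟩ h
    rw [← heq]; nth_rw 1 [hc]; nth_rw 1 [hd]; ring

theorem IsNonderogatory.nonempty_equiv {M : Matrix ι ι ℝ} (hM : IsNonderogatory M) :
    Nonempty (G M ≃ₗ⁅ℝ⁆ AffLie (PolyQuot M.charpoly)) := by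
  obtain ⟨v, hv⟩ := exists_minpoly_dvd_of_mulVec_eq_zero M
  refine nonempty_equiv_of_cyclic M.charpoly_natDegree_eq_dim
    M.aeval_self_charpoly (v := v) ?_
  rw [show M.charpoly = minpoly ℝ M from hM]
  exact hv

end CyclicVector

/-! ### The model matrices as operators on sequences extended by zero. -/

/-- Extension of a vector by zero to a sequence. -/
def extendZero {n : ℕ} (x : Fin n → ℝ) (j : ℕ) : ℝ := if h : j < n then x ⟨j, h⟩ else 0

lemma extendZero_val {n : ℕ} (x : Fin n → ℝ) (j : Fin n) : extendZero x j = x j := by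
  simp [extendZero]

lemma extendZero_of_le {n : ℕ} (x : Fin n → ℝ) {j : ℕ} (h : n ≤ j) : extendZero x j = 0 := by
  simp [extendZero, h]

lemma extendZero_injective {n : ℕ} : Function.Injective (extendZero (n := n)) := fun x y h => by
  funext j
  rw [← extendZero_val x, h, extendZero_val]

lemma extendZero_add {n : ℕ} (x y : Fin n → ℝ) (j : ℕ) :
    extendZero (x + y) j = extendZero x j + extendZero y j := by
  unfold extendZero; split_ifs <;> simp

lemma sum_ite_eq_extendZero {n : ℕ} (x : Fin n → ℝ) (a : ℕ) (c : ℝ) :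
    ∑ i : Fin n, (if (i : ℕ) = a then c else 0) * x i = c * extendZero x a := by
  unfold extendZero
  split_ifs with h
  · rw [Finset.sum_eq_single ⟨a, h⟩]
    · simp
    · intro b _ hb
      rw [if_neg fun h' => hb (Fin.ext h'), zero_mul]
    · simp
  · rw [mul_zero]
    refine Finset.sum_eq_zero fun i _ => ?_
    rw [if_neg (by have := i.2; omega), zero_mul]

lemma extendZero_M₀_mulVec {n : ℕ} (x : Fin n → ℝ) (j : ℕ) :
    extendZero ((M₀ n).mulVec x) j = extendZero x (j + 1) := by
  by_cases h : j < n
  · rw [← one_mul (extendZero x (j + 1)), ← sum_ite_eq_extendZero]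
    simp [extendZero, h, Matrix.mulVec, dotProduct, M₀]
  · rw [extendZero_of_le _ (by omega), extendZero_of_le _ (by omega)]

lemma extendZero_M₀_pow_mulVec {n : ℕ} (r : ℕ) (x : Fin n → ℝ) (j : ℕ) :
    extendZero ((M₀ n ^ r).mulVec x) j = extendZero x (j + r) := by
  induction r generalizing x with
  | zero => simp
  | succ r ih => rw [pow_succ, ← Matrix.mulVec_mulVec, ih, extendZero_M₀_mulVec, add_assoc]

lemma M₀_pow_self (n : ℕ) : M₀ n ^ n = 0 := by
  apply Matrix.mulVec_injective
  funext x
  apply extendZero_injective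
  funext j
  rw [extendZero_M₀_pow_mulVec, extendZero_of_le _ (by omega), Matrix.zero_mulVec]
  simp [extendZero]

/-- The `k`-th power of the shift carries the last basis vector to the first. -/
lemma M₀_pow_mulVec_ne_zero (k : ℕ) :
    (M₀ (k + 1) ^ k).mulVec (Pi.single (Fin.last k) 1) ≠ 0 := by
  intro h
  have := extendZero_M₀_pow_mulVec k (Pi.single (Fin.last k) (1 : ℝ)) 0
  rw [h, zero_add] at this
  change _ = extendZero _ ((Fin.last k : Fin (k + 1)) : ℕ) at this
  rw [extendZero_val, Pi.single_eq_same] at this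
  simp [extendZero] at this

/-- The truncated subtraction `j - 1` is harmless, since it occurs only for odd `j`. -/
lemma extendZero_M₀₁_mulVec {m : ℕ} (x : Fin (2 * m) → ℝ) (j : ℕ) :
    extendZero ((M₀₁ (2 * m)).mulVec x) j =
      if Even j then -extendZero x (j + 1) + extendZero x (j + 2)
      else extendZero x (j - 1) + extendZero x (j + 2) := by
  by_cases h : j < 2 * m
  · rw [← one_mul (extendZero x (j + 2)), ← neg_one_mul, ← one_mul (extendZero x (j - 1))]
    simp only [← sum_ite_eq_extendZero, ← Finset.sum_add_distrib]
    rw [← Finset.sum_ite_irrel]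
    rw [extendZero, dif_pos h, Matrix.mulVec, dotProduct]
    refine Finset.sum_congr rfl fun i _ => ?_
    rw [M₀₁, Matrix.add_apply, Mₛ, Mₙ, Matrix.of_apply, Matrix.of_apply]
    simp only [Nat.even_iff]
    by_cases hj : j % 2 = 0
    · rw [if_neg (show ¬ ((i : ℕ) % 2 = 0 ∧ j = i + 1) by omega)]
      simp only [hj, true_and, if_true, ← add_mul]
    · have h₁ : ((i : ℕ) % 2 = 0 ∧ j = i + 1) ↔ (i : ℕ) = j - 1 := by omega
      simp only [hj, false_and, if_false, ← add_mul, h₁]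
  · rw [extendZero_of_le _ (by omega)]
    split_ifs with hj
    · rw [extendZero_of_le _ (by omega), extendZero_of_le _ (by omega), neg_zero, add_zero]
    · rw [Nat.even_iff] at hj
      rw [extendZero_of_le _ (by omega), extendZero_of_le _ (by omega), add_zero]

/-- With J = `Mₛ` and N = `Mₙ`, J² = -1 and JN = NJ, so the matrix is 2JN + N². It moves blocks of
two coordinates by one or two blocks, which gives nilpotency. -/
lemma extendZero_M₀₁_sq_add_one_mulVec {m : ℕ} (x : Fin (2 * m) → ℝ) (j : ℕ) :
    extendZero ((M₀₁ (2 * m) ^ 2 + 1).mulVec x) j =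
      if Even j then -2 * extendZero x (j + 3) + extendZero x (j + 4)
      else 2 * extendZero x (j + 1) + extendZero x (j + 4) := by
  rw [Matrix.add_mulVec, extendZero_add, Matrix.one_mulVec, sq, ← Matrix.mulVec_mulVec]
  simp only [extendZero_M₀₁_mulVec]
  rcases Nat.even_or_odd' j with ⟨c, rfl | rfl⟩
  · have h₁ : Even (2 * c) := by simp
    have h₂ : ¬ Even (2 * c + 1) := by simp
    have h₃ : Even (2 * c + 2) := by simp [Nat.even_add]
    simp only [h₁, h₂, h₃, if_true, if_false, Nat.add_sub_cancel]
    ring_nf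
  · have h₁ : Even (2 * c) := by simp
    have h₂ : ¬ Even (2 * c + 1) := by simp
    have h₃ : ¬ Even (2 * c + 1 + 2) := by simp [Nat.even_add]
    simp only [h₁, h₂, h₃, if_true, if_false, Nat.add_sub_cancel,
      show 2 * c + 1 + 2 - 1 = 2 * c + 2 by omega]
    ring_nf

lemma extendZero_M₀₁_sq_add_one_pow_mulVec {m : ℕ} (r : ℕ) (x : Fin (2 * m) → ℝ) {j : ℕ}
    (h : 2 * m ≤ j + 2 * r) : extendZero (((M₀₁ (2 * m) ^ 2 + 1) ^ r).mulVec x) j = 0 := by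
  induction r generalizing j with
  | zero => exact extendZero_of_le _ (by omega)
  | succ r ih =>
    rw [pow_succ', ← Matrix.mulVec_mulVec, extendZero_M₀₁_sq_add_one_mulVec]
    split_ifs with hj
    · rw [ih (by omega), ih (by omega)]; simp
    -- For odd `j` the index grows by only 1; the bound survives because `2 * m` is even.
    · rw [Nat.even_iff] at hj
      rw [ih (by omega), ih (by omega)]; simp

lemma M₀₁_sq_add_one_pow_self (m : ℕ) : (M₀₁ (2 * m) ^ 2 + 1) ^ m = 0 := by
  apply Matrix.mulVec_injective
  funext x
  apply extendZero_injective
  funext j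
  rw [extendZero_M₀₁_sq_add_one_pow_mulVec m x (by omega), Matrix.zero_mulVec]
  simp [extendZero]

lemma M₀₁_sq_add_one_pow_mulVec_ne_zero (k : ℕ) :
    ((M₀₁ (2 * (k + 1)) ^ 2 + 1) ^ k).mulVec (fun _ => 1) ≠ 0 := by
  -- After `r` steps, block `s` = k - r is the last one that can be nonzero. The terms two blocks
  -- away vanish, so each step exchanges the two entries of that block up to factors ±2, and neither
  -- becomes zero.
  have key : ∀ r s, r + s = k →
      extendZero (((M₀₁ (2 * (k + 1)) ^ 2 + 1) ^ r).mulVec (fun _ => 1)) (2 * s) ≠ 0 ∧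
      extendZero (((M₀₁ (2 * (k + 1)) ^ 2 + 1) ^ r).mulVec (fun _ => 1)) (2 * s + 1) ≠ 0 := by
    intro r
    induction r with
    | zero =>
      intro s hs
      rw [pow_zero, Matrix.one_mulVec, extendZero, extendZero, dif_pos (by omega),
        dif_pos (by omega)]
      simp
    | succ r ih =>
      intro s hs
      obtain ⟨h₁, h₂⟩ := ih (s + 1) (by omega)
      have h₃ : Even (2 * s) := by simp
      have h₄ : ¬ Even (2 * s + 1) := by simp
      rw [pow_succ', ← Matrix.mulVec_mulVec, extendZero_M₀₁_sq_add_one_mulVec,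
        extendZero_M₀₁_sq_add_one_mulVec, if_pos h₃, if_neg h₄,
        extendZero_M₀₁_sq_add_one_pow_mulVec r _ (show 2 * (k + 1) ≤ 2 * s + 4 + 2 * r by omega),
        extendZero_M₀₁_sq_add_one_pow_mulVec r _ (show 2 * (k + 1) ≤ 2 * s + 1 + 4 + 2 * r by omega)]
      rw [show 2 * (s + 1) = 2 * s + 1 + 1 by ring] at h₁ h₂
      exact ⟨by simpa using h₂, by simpa using h₁⟩
  intro h
  have := (key k 0 (add_zero k)).1
  rw [h] at this
  simp [extendZero] at this

theorem nonempty_D₀_equiv (k : ℕ) : Nonempty (D₀ k ≃ₗ⁅ℝ⁆ AffLie (PolyQuot (X ^ k))) := by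
  have hM : aeval (M₀ k) (X ^ k : ℝ[X]) = 0 := by rw [map_pow, aeval_X, M₀_pow_self]
  cases k with
  | zero => exact nonempty_equiv_of_cyclic (v := 0) (by simp) hM fun p _ => by simp
  | succ k =>
    refine nonempty_equiv_of_cyclic (v := Pi.single (Fin.last k) 1) (by simp) hM
      (pow_dvd_of_mulVec_eq_zero prime_X hM ?_)
    rw [map_pow, aeval_X]
    exact M₀_pow_mulVec_ne_zero k

theorem nonempty_D₀₁_equiv (m : ℕ) :
    Nonempty (D₀₁ (2 * m) ≃ₗ⁅ℝ⁆ AffLie (PolyQuot ((X ^ 2 + 1) ^ m))) := by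
  have hq : aeval (M₀₁ (2 * m)) (X ^ 2 + 1 : ℝ[X]) = M₀₁ (2 * m) ^ 2 + 1 := by simp
  have hM : aeval (M₀₁ (2 * m)) ((X ^ 2 + 1) ^ m : ℝ[X]) = 0 := by
    rw [map_pow, hq, M₀₁_sq_add_one_pow_self]
  have hdeg : ((X ^ 2 + 1 : ℝ[X]) ^ m).natDegree = Fintype.card (Fin (2 * m)) := by
    rw [natDegree_pow, show (X ^ 2 + 1 : ℝ[X]).natDegree = 2 by compute_degree!, Fintype.card_fin,
      mul_comm]
  cases m with
  | zero => exact nonempty_equiv_of_cyclic (v := 0) hdeg hM fun p _ => by simp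
  | succ k =>
    have hprime : Prime (X ^ 2 + 1 : ℝ[X]) := by
      -- At z = I the quadratic is X² + 1.
      have h := (pairPoly_irreducible (z := Complex.I) (by simp)).prime
      simpa [pairPoly] using h
    refine nonempty_equiv_of_cyclic (v := fun _ => 1) hdeg hM
      (pow_dvd_of_mulVec_eq_zero hprime hM ?_)
    rw [map_pow, hq]
    exact M₀₁_sq_add_one_pow_mulVec_ne_zero k

/-! ### Factorization of a real polynomial and the resulting direct sum. -/

lemma isCoprime_X_sub_C_pairPoly (x : ℝ) {z : ℂ} (hz : z.im ≠ 0) :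
    IsCoprime (X - C x) (pairPoly z) := by
  rw [(irreducible_X_sub_C x).coprime_iff_not_dvd]
  intro h
  have h₁ := degree_eq_degree_of_associated
    ((irreducible_X_sub_C x).associated_of_dvd (pairPoly_irreducible hz) h)
  rw [degree_X_sub_C, degree_eq_natDegree (pairPoly_monic z).ne_zero, natDegree_pairPoly] at h₁
  norm_num at h₁

lemma isCoprime_pairPoly {z w : ℂ} (hz : z.im ≠ 0) (h₁ : z ≠ w)
    (h₂ : z ≠ starRingEnd ℂ w) : IsCoprime (pairPoly z) (pairPoly w) := by
  rw [(pairPoly_irreducible hz).coprime_iff_not_dvd]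
  intro h
  rw [← aeval_eq_zero_iff_pairPoly_dvd hz, aeval_pairPoly] at h
  rcases mul_eq_zero.1 h with h | h
  · exact h₁ (sub_eq_zero.1 h)
  · exact h₂ (sub_eq_zero.1 h)

/-- A polynomial all of whose nontrivial divisors are divisible by one of the given primes is the
product of the powers of these primes that divide it. -/
lemma eq_prod_pow_multiplicity {κ : Type*} [Fintype κ] {π : κ → ℝ[X]} {f : ℝ[X]} (hf : f.Monic)
    (hπ : ∀ i, (π i).Monic) (hirr : ∀ i, Irreducible (π i))
    (hco : Pairwise (Function.onFun IsCoprime π))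
    (hdvd : ∀ h, h ∣ f → ¬ IsUnit h → ∃ i, π i ∣ h) :
    f = ∏ i, π i ^ multiplicity (π i) f := by
  have hP : ∏ i, π i ^ multiplicity (π i) f ∣ f :=
    Fintype.prod_dvd_of_coprime (fun i j hij => (hco hij).pow) fun i => pow_multiplicity_dvd _ _
  obtain ⟨h, hh⟩ := hP
  have hu : IsUnit h := by
    -- Otherwise some `π i` divides the cofactor, and one more power of `π i` divides `f`.
    by_contra hu
    obtain ⟨i, hi⟩ := hdvd h (Dvd.intro_left _ hh.symm) hu
    have hfin : FiniteMultiplicity (π i) f :=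
      FiniteMultiplicity.of_not_isUnit (hirr i).not_isUnit hf.ne_zero
    refine hfin.not_pow_dvd_of_multiplicity_lt (Nat.lt_succ_self _) ?_
    rw [pow_succ]
    refine dvd_trans ?_ (dvd_of_eq hh.symm)
    exact mul_dvd_mul (Finset.dvd_prod_of_mem _ (Finset.mem_univ i)) hi
  have hassoc : Associated (∏ i, π i ^ multiplicity (π i) f) f := by
    nth_rw 2 [hh]
    exact associated_mul_unit_right _ _ hu
  exact (eq_of_monic_of_associated (monic_prod_of_monic _ _ fun i _ => (hπ i).pow _) hf
    hassoc).symm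

section Roots

variable {ι κ : Type*} {lam : ι → ℝ} {z : κ → ℂ}

lemma pairwise_isCoprime_sumElim (hlam : Function.Injective lam) (hz : ∀ j, (z j).im ≠ 0)
    (hzz : ∀ j j', j ≠ j' → z j ≠ z j' ∧ z j ≠ starRingEnd ℂ (z j')) :
    Pairwise (Function.onFun IsCoprime
      (Sum.elim (fun i => X - C (lam i)) fun j => pairPoly (z j))) := by
  rintro (i | i) (j | j) hij
  · exact pairwise_coprime_X_sub_C hlam fun h => hij (congrArg _ h)
  · exact isCoprime_X_sub_C_pairPoly _ (hz j)
  · exact (isCoprime_X_sub_C_pairPoly _ (hz i)).symm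
  · obtain ⟨h₁, h₂⟩ := hzz i j fun h => hij (congrArg _ h)
    exact isCoprime_pairPoly (hz i) h₁ h₂

variable [Fintype ι] [Fintype κ]

/-- The factorization of a monic real polynomial in terms of its complex roots. -/
lemma eq_prod_of_roots {f : ℝ[X]} (hf : f.Monic) (hlam : Function.Injective lam)
    (hroot : ∀ x : ℝ, f.IsRoot x → ∃ i, lam i = x) (hz : ∀ j, (z j).im ≠ 0)
    (hzz : ∀ j j', j ≠ j' → z j ≠ z j' ∧ z j ≠ starRingEnd ℂ (z j'))
    (hcroot : ∀ w : ℂ, w.im ≠ 0 → aeval w f = 0 → ∃ j, w = z j ∨ w = starRingEnd ℂ (z j)) :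
    f = (∏ i, (X - C (lam i)) ^ f.rootMultiplicity (lam i)) *
      ∏ j, pairPoly (z j) ^ multiplicity (pairPoly (z j)) f := by
  classical
  have h := eq_prod_pow_multiplicity
    (π := Sum.elim (fun i => X - C (lam i)) fun j => pairPoly (z j)) hf
    (by rintro (i | j); exacts [monic_X_sub_C _, pairPoly_monic _])
    (by rintro (i | j); exacts [irreducible_X_sub_C _, pairPoly_irreducible (hz j)])
    (pairwise_isCoprime_sumElim hlam hz hzz)
    (by
      intro h hd hu
      have h0 : h ≠ 0 := by rintro rfl; exact hf.ne_zero (zero_dvd_iff.1 hd)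
      obtain ⟨w, hw⟩ := IsAlgClosed.exists_aeval_eq_zero ℂ h
        (degree_pos_of_ne_zero_of_nonunit h0 hu).ne'
      have hwf : aeval w f = 0 := by
        obtain ⟨r, rfl⟩ := hd
        rw [map_mul, hw, zero_mul]
      by_cases him : w.im = 0
      · obtain ⟨x, rfl⟩ : ∃ x, w = algebraMap ℝ ℂ x :=
          ⟨w.re, Complex.ext (by simp) (by simp [him])⟩
        rw [aeval_algebraMap_apply, Complex.coe_algebraMap, Complex.ofReal_eq_zero,
          coe_aeval_eq_eval] at hw hwf
        obtain ⟨i, hi⟩ := hroot _ hwf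
        refine ⟨Sum.inl i, dvd_iff_isRoot.2 ?_⟩
        rw [hi]
        exact hw
      · obtain ⟨j, hj | hj⟩ := hcroot w him hwf
        · exact ⟨Sum.inr j, (aeval_eq_zero_iff_pairPoly_dvd (hz j) h).1 (hj ▸ hw)⟩
        · refine ⟨Sum.inr j, (aeval_eq_zero_iff_pairPoly_dvd (hz j) h).1 ?_⟩
          rw [← Complex.conj_conj (z j), ← hj]
          exact (aeval_conj h w).trans (by rw [hw, map_zero]))
  rw [Fintype.prod_sum_type] at h
  simpa only [Sum.elim_inl, Sum.elim_inr, rootMultiplicity_eq_multiplicity, if_neg hf.ne_zero]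
    using h

variable [DecidableEq ι] [DecidableEq κ]

/-- The affine Lie algebra of `ℝ[X]/(f)`, from the factorization of `f`. -/
theorem nonempty_affLie_equiv_directSum (hlam : Function.Injective lam) (hz : ∀ j, (z j).im ≠ 0)
    (hzz : ∀ j j', j ≠ j' → z j ≠ z j' ∧ z j ≠ starRingEnd ℂ (z j')) (k : ι → ℕ) (m : κ → ℕ) :
    Nonempty (AffLie (PolyQuot ((∏ i, (X - C (lam i)) ^ k i) * ∏ j, pairPoly (z j) ^ m j)) ≃ₗ⁅ℝ⁆
      ((⨁ i, D₀ (k i)) × (⨁ j, D₀₁ (2 * m j)))) := by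
  have hco := pairwise_isCoprime_sumElim hlam hz hzz
  have h₁ : Pairwise (Function.onFun IsCoprime fun i => (X - C (lam i)) ^ k i) := fun i j hij =>
    (hco (Sum.inl_injective.ne hij)).pow
  have h₂ : Pairwise (Function.onFun IsCoprime fun j => pairPoly (z j) ^ m j) := fun i j hij =>
    (hco (Sum.inr_injective.ne hij)).pow
  have h₃ : IsCoprime (∏ i, (X - C (lam i)) ^ k i) (∏ j, pairPoly (z j) ^ m j) :=
    IsCoprime.prod_left fun i _ => IsCoprime.prod_right fun j _ =>
      (hco (show Sum.inl i ≠ Sum.inr j from Sum.inl_ne_inr)).pow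
  exact ⟨(AffLie.congr (quotMulEquiv h₃)).trans (AffLie.prodEquiv
    ((AffLie.congr (quotProdEquiv h₁)).trans (AffLie.piEquiv fun i =>
      (AffLie.congr (quotLinearPowEquiv (lam i) (k i))).trans (nonempty_D₀_equiv (k i)).some.symm))
    ((AffLie.congr (quotProdEquiv h₂)).trans (AffLie.piEquiv fun j =>
      (AffLie.congr (quotPairPowEquiv (hz j) (m j))).trans (nonempty_D₀₁_equiv (m j)).some.symm)))⟩

end Roots

/-! ### Eigenvalues as roots of the characteristic polynomial. -/

section Eigenvalues

variable {ι : Type*} [Fintype ι] [DecidableEq ι] {M : Matrix ι ι ℝ}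

lemma isRealEigenvalue_iff {x : ℝ} : IsRealEigenvalue M x ↔ M.charpoly.IsRoot x := by
  rw [IsRealEigenvalue, Module.End.hasEigenvalue_iff_isRoot_charpoly, Matrix.charpoly_toLin']

lemma isComplexEigenvalue_iff {w : ℂ} : IsComplexEigenvalue M w ↔ aeval w M.charpoly = 0 := by
  rw [IsComplexEigenvalue, Module.End.hasEigenvalue_iff_isRoot_charpoly, Matrix.charpoly_toLin',
    show M.map Complex.ofReal = M.map (algebraMap ℝ ℂ) from rfl, Matrix.charpoly_map, IsRoot.def,
    eval_map_algebraMap]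

lemma isComplexEigenvalue_ofReal_iff {x : ℝ} :
    IsComplexEigenvalue M (x : ℂ) ↔ M.charpoly.IsRoot x := by
  rw [isComplexEigenvalue_iff, ← Complex.coe_algebraMap, aeval_algebraMap_apply,
    Complex.coe_algebraMap, Complex.ofReal_eq_zero, coe_aeval_eq_eval, IsRoot.def]

end Eigenvalues

/-! ### The characteristic polynomial in the special cases. -/

section Cases

variable {n : ℕ} {M : Matrix (Fin n) (Fin n) ℝ}

lemma natDegree_prod_pow {ι κ : Type*} [Fintype ι] [Fintype κ] (lam : ι → ℝ) (z : κ → ℂ)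
    (k : ι → ℕ) (m : κ → ℕ) :
    ((∏ i, (X - C (lam i)) ^ k i) * ∏ j, pairPoly (z j) ^ m j).natDegree =
      ∑ i, k i + 2 * ∑ j, m j := by
  have h₁ : ∀ i ∈ Finset.univ, ((X - C (lam i)) ^ k i).Monic := fun i _ => (monic_X_sub_C _).pow _
  have h₂ : ∀ j ∈ Finset.univ, (pairPoly (z j) ^ m j).Monic := fun j _ => (pairPoly_monic _).pow _
  rw [(monic_prod_of_monic _ _ h₁).natDegree_mul (monic_prod_of_monic _ _ h₂),
    natDegree_prod_of_monic _ _ h₁, natDegree_prod_of_monic _ _ h₂, Finset.mul_sum]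
  simp [natDegree_pow, natDegree_pairPoly, mul_comm]

lemma charpoly_eq_prod_of_injective {lam : Fin n → ℝ} (hlam : Function.Injective lam)
    (h : ∀ i, IsRealEigenvalue M (lam i)) : M.charpoly = ∏ i, (X - C (lam i)) := by
  refine eq_of_monic_of_dvd_of_natDegree_le (monic_prod_of_monic _ _ fun i _ => monic_X_sub_C _)
    M.charpoly_monic ?_ ?_
  · exact Fintype.prod_dvd_of_coprime (pairwise_coprime_X_sub_C hlam) fun i =>
      dvd_iff_isRoot.2 (isRealEigenvalue_iff.1 (h i))
  · rw [M.charpoly_natDegree_eq_dim, natDegree_prod_of_monic _ _ fun i _ => monic_X_sub_C _]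
    simp

lemma charpoly_eq_pow_of_unique_real {x : ℝ} (h : ∀ w : ℂ, IsComplexEigenvalue M w ↔ w = x) :
    M.charpoly = (X - C x) ^ n := by
  have hf := eq_prod_of_roots (f := M.charpoly) (lam := fun _ : Unit => x) (z := Empty.elim)
    M.charpoly_monic (Function.injective_of_subsingleton _)
    (fun y hy => ⟨(), by
      simpa using ((h y).1 (isComplexEigenvalue_ofReal_iff.2 hy)).symm⟩)
    (fun j => j.elim) (fun j => j.elim)
    (fun w hw hw' => by
      rw [(h w).1 (isComplexEigenvalue_iff.2 hw')] at hw
      simp at hw)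
  have hd := congrArg natDegree hf
  rw [natDegree_prod_pow, M.charpoly_natDegree_eq_dim] at hd
  simp only [Finset.univ_unique, Finset.prod_singleton, Finset.univ_eq_empty, Finset.prod_empty,
    mul_one, Finset.sum_singleton, Finset.sum_empty, mul_zero, add_zero, Fintype.card_fin] at hf hd
  exact hf.trans (by rw [← hd])

lemma charpoly_eq_pow_of_pair {z : ℂ} (hz : z.im ≠ 0)
    (h : ∀ w : ℂ, IsComplexEigenvalue M w ↔ w = z ∨ w = starRingEnd ℂ z) :
    ∃ m, n = 2 * m ∧ M.charpoly = pairPoly z ^ m := by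
  have hf := eq_prod_of_roots (f := M.charpoly) (lam := Empty.elim) (z := fun _ : Unit => z)
    M.charpoly_monic (Function.injective_of_subsingleton _)
    (fun y hy => by
      rcases (h y).1 (isComplexEigenvalue_ofReal_iff.2 hy) with h | h
      · exact absurd (by rw [← h, Complex.ofReal_im]) hz
      · refine absurd ?_ hz
        rw [← Complex.conj_conj z, ← h, Complex.conj_ofReal, Complex.ofReal_im])
    (fun _ => hz) (fun _ _ hne => absurd rfl hne)
    (fun w _ hw => ⟨(), (h w).1 (isComplexEigenvalue_iff.2 hw)⟩)
  have hd := congrArg natDegree hf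
  rw [natDegree_prod_pow, M.charpoly_natDegree_eq_dim] at hd
  simp only [Finset.univ_unique, Finset.prod_singleton, Finset.univ_eq_empty, Finset.prod_empty,
    one_mul, Finset.sum_singleton, Finset.sum_empty, zero_add, Fintype.card_fin] at hf hd
  exact ⟨_, hd, hf⟩

lemma prod_pairPoly_dvd_charpoly {κ : Type*} [Fintype κ] {z : κ → ℂ}
    (hz : ∀ i, (z i).im ≠ 0) (hco : Pairwise (Function.onFun IsCoprime fun i => pairPoly (z i)))
    (h : ∀ i, IsComplexEigenvalue M (z i)) :
    ∏ i, pairPoly (z i) ∣ M.charpoly ∧ (∏ i, pairPoly (z i)).natDegree = 2 * Fintype.card κ := by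
  refine ⟨Fintype.prod_dvd_of_coprime hco fun i =>
    (aeval_eq_zero_iff_pairPoly_dvd (hz i) _).1 (isComplexEigenvalue_iff.1 (h i)), ?_⟩
  rw [natDegree_prod_of_monic _ _ fun i _ => pairPoly_monic _]
  simp [natDegree_pairPoly, mul_comm]

/-- The roots in one open half-plane give pairwise coprime quadratics dividing a polynomial of
degree `n`, so there are at most `n / 2` of them. The two half-planes share all `n` roots, so each
holds exactly half, and the upper one already exhausts the degree. -/
lemma charpoly_eq_prod_pairPoly {z : Fin n → ℂ} (hinj : Function.Injective z)
    (h : ∀ i, (z i).im ≠ 0 ∧ IsComplexEigenvalue M (z i)) :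
    ∃ (κ : Finset (Fin n)), n = 2 * κ.card ∧
      Pairwise (Function.onFun IsCoprime fun i : κ => pairPoly (z i)) ∧
      M.charpoly = ∏ i : κ, pairPoly (z i) := by
  have key : ∀ κ : Finset (Fin n), (∀ i ∈ κ, ∀ j ∈ κ, 0 < (z i).im * (z j).im) →
      Pairwise (Function.onFun IsCoprime fun i : κ => pairPoly (z i)) := by
    intro κ hκ i j hij
    refine isCoprime_pairPoly (h i).1 (hinj.ne (Subtype.coe_injective.ne hij)) fun he => ?_
    have hpos := hκ i i.2 j j.2
    rw [he, Complex.conj_im] at hpos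
    nlinarith [sq_nonneg (z j).im]
  have hle : ∀ κ : Finset (Fin n), (∀ i ∈ κ, ∀ j ∈ κ, 0 < (z i).im * (z j).im) →
      2 * κ.card ≤ n := by
    intro κ hκ
    obtain ⟨hd, hn⟩ := prod_pairPoly_dvd_charpoly (z := fun i : κ => z i) (fun i => (h i).1)
      (key κ hκ) fun i => (h i).2
    have := natDegree_le_of_dvd hd M.charpoly_monic.ne_zero
    rwa [hn, M.charpoly_natDegree_eq_dim, Fintype.card_coe, Fintype.card_fin] at this
  let S := Finset.univ.filter fun i => 0 < (z i).im
  have hS : ∀ i ∈ S, ∀ j ∈ S, 0 < (z i).im * (z j).im := fun i hi j hj =>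
    mul_pos (Finset.mem_filter.1 hi).2 (Finset.mem_filter.1 hj).2
  have hT : ∀ i ∈ Sᶜ, ∀ j ∈ Sᶜ, 0 < (z i).im * (z j).im := by
    have : ∀ i ∈ Sᶜ, (z i).im < 0 := fun i hi =>
      lt_of_le_of_ne (by simpa [S] using hi) (h i).1
    exact fun i hi j hj => mul_pos_of_neg_of_neg (this i hi) (this j hj)
  have hcard : S.card + Sᶜ.card = n := by rw [Finset.card_add_card_compl, Fintype.card_fin]
  have hn : n = 2 * S.card := by
    have := hle S hS
    have := hle Sᶜ hT
    omega
  refine ⟨S, hn, key S hS, ?_⟩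
  obtain ⟨hd, hdeg⟩ := prod_pairPoly_dvd_charpoly (z := fun i : S => z i) (fun i => (h i).1)
    (key S hS) fun i => (h i).2
  refine eq_of_monic_of_dvd_of_natDegree_le (monic_prod_of_monic _ _ fun i _ => pairPoly_monic _)
    M.charpoly_monic hd ?_
  rw [hdeg, M.charpoly_natDegree_eq_dim, Fintype.card_coe, Fintype.card_fin]
  exact hn.le

end Cases

end NonderogatoryLie

end

open NonderogatoryLie in
theorem mainTheorem5 (n : ℕ) (M : Matrix (Fin n) (Fin n) ℝ) (hM : IsNonderogatory M) :
    -- general case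
    (∀ (p q : ℕ) (lam : Fin p → ℝ) (z : Fin q → ℂ) (k : Fin p → ℕ) (m : Fin q → ℕ),
      -- `lam` lists the distinct real eigenvalues of `M`
      Function.Injective lam →
      (∀ x : ℝ, IsRealEigenvalue M x ↔ ∃ i, lam i = x) →
      -- `z, conj z` lists the distinct nonreal eigenvalues of `M`
      (∀ j, (z j).im ≠ 0) →
      (∀ j j', j ≠ j' → z j ≠ z j' ∧ z j ≠ starRingEnd ℂ (z j')) →
      (∀ w : ℂ, w.im ≠ 0 →
        (IsComplexEigenvalue M w ↔ ∃ j, w = z j ∨ w = starRingEnd ℂ (z j))) →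
      -- with their multiplicities
      (∀ i, k i = realMultiplicity M (lam i)) →
      (∀ j, m j = pairMultiplicity M (z j)) →
      n = ∑ i, k i + 2 * ∑ j, m j ∧
      Nonempty (G M ≃ₗ⁅ℝ⁆ ((⨁ i, D₀ (k i)) × (⨁ j, D₀₁ (2 * m j))))) ∧
    -- (a) `n` distinct real eigenvalues
    ((∃ lam : Fin n → ℝ, Function.Injective lam ∧ ∀ i, IsRealEigenvalue M (lam i)) →
      Nonempty (G M ≃ₗ⁅ℝ⁆ (⨁ _ : Fin n, aff ℝ))) ∧
    -- (b) a unique eigenvalue, which is real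
    ((∃ lam : ℝ, ∀ w : ℂ, IsComplexEigenvalue M w ↔ w = lam) →
      Nonempty (G M ≃ₗ⁅ℝ⁆ D₀ n)) ∧
    -- (c) `n` distinct nonreal eigenvalues
    ((∃ z : Fin n → ℂ, Function.Injective z ∧
        ∀ i, (z i).im ≠ 0 ∧ IsComplexEigenvalue M (z i)) →
      Even n ∧ Nonempty (G M ≃ₗ⁅ℝ⁆ (⨁ _ : Fin (n / 2), aff ℂ))) ∧
    -- (d) exactly two eigenvalues, nonreal and conjugate
    ((∃ z : ℂ, z.im ≠ 0 ∧
        ∀ w : ℂ, IsComplexEigenvalue M w ↔ w = z ∨ w = starRingEnd ℂ z) →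
      Even n ∧ Nonempty (G M ≃ₗ⁅ℝ⁆ D₀₁ n)) := by
  obtain ⟨e⟩ := hM.nonempty_equiv
  refine ⟨?_, ?_, ?_, ?_, ?_⟩
  · intro p q lam z k m hlam hreal hz hzz hcomplex hk hm
    have hf := eq_prod_of_roots M.charpoly_monic hlam
      (fun x hx => (hreal x).1 (isRealEigenvalue_iff.2 hx)) hz hzz
      (fun w hw hw' => (hcomplex w hw).1 (isComplexEigenvalue_iff.2 hw'))
    have hf' : M.charpoly = (∏ i, (Polynomial.X - Polynomial.C (lam i)) ^ k i) *
        ∏ j, pairPoly (z j) ^ m j := by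
      refine hf.trans (congrArg₂ _ ?_ ?_)
      · exact Finset.prod_congr rfl fun i _ => by rw [hk i]; rfl
      · exact Finset.prod_congr rfl fun j _ => by rw [hm j]; rfl
    refine ⟨?_, ?_⟩
    · rw [← natDegree_prod_pow lam z k m, ← hf', M.charpoly_natDegree_eq_dim, Fintype.card_fin]
    · obtain ⟨e'⟩ := nonempty_affLie_equiv_directSum hlam hz hzz k m
      rw [← hf'] at e'
      exact ⟨e.trans e'⟩
  · rintro ⟨lam, hlam, h⟩
    rw [charpoly_eq_prod_of_injective hlam h] at e
    exact ⟨e.trans ((AffLie.congr (quotProdEquiv (Polynomial.pairwise_coprime_X_sub_C hlam))).trans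
      (AffLie.piEquiv fun i => (AffLie.congr (quotLinearEquiv (lam i))).trans
        (AffLie.equivAff ℝ)))⟩
  · rintro ⟨x, h⟩
    rw [charpoly_eq_pow_of_unique_real h] at e
    obtain ⟨e'⟩ := nonempty_D₀_equiv n
    exact ⟨e.trans ((AffLie.congr (quotLinearPowEquiv x n)).trans e'.symm)⟩
  · rintro ⟨z, hinj, h⟩
    obtain ⟨S, hn, hco, hf⟩ := charpoly_eq_prod_pairPoly hinj h
    refine ⟨⟨S.card, by omega⟩, ?_⟩
    -- Reindexes the roots of the upper half-plane by `Fin (n / 2)`.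
    let σ : Fin (n / 2) ≃ S := (finCongr (by omega)).trans S.equivFin.symm
    rw [hf, ← Equiv.prod_comp σ] at e
    exact ⟨e.trans ((AffLie.congr (quotProdEquiv (hco.comp_of_injective σ.injective))).trans
      (AffLie.piEquiv fun i => (AffLie.congr (quotPairEquiv (h (σ i)).1)).trans
        (AffLie.equivAff ℂ)))⟩
  · rintro ⟨z, hz, h⟩
    obtain ⟨m, rfl, hf⟩ := charpoly_eq_pow_of_pair hz h
    rw [hf] at e
    obtain ⟨e'⟩ := nonempty_D₀₁_equiv m
    exact ⟨even_two_mul m, ⟨e.trans ((AffLie.congr (quotPairPowEquiv hz m)).trans e'.symm)⟩⟩
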